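/- For a finite graph $G$ with degrees $d_1,\dots,d_n$ let $e_p(G)=\sum_{i=1}^n d_i^p$, and let $\mathrm{ex}_p(n,F)$ be the maximum of $e_p(G)$ over all graphs $G$ on $n$ vertices that do not contain $F$ as a (not necessarily induced) subgraph; such a $G$ attaining the maximum is called extremal. Let $P_m$ be the path on $m$ vertices, $K_m$ the complete graph and $E_m$ the edgeless graph on $m$ vertices, and let $+$ denote the join of two vertex-disjoint graphs (all edges between them are added). Let $k\ge 2$, let $\ell_1,\dots,\ell_k\ge 2$ be integers, not all equal to $3$, and let $F=\bigcup_{i=1}^k P_{\ell_i}$ be the vertex-disjoint union of the paths. Put $b=\sum_{i=1}^k\lfloor \ell_i/2\rfloor-1$, and let $H(n,F)$ be $K_b+E_{n-b}$ with a single edge added inside the part $E_{n-b}$ if all $\ell_i$ are odd, and $H(n,F)=K_b+E_{n-b}$ otherwise. Then there is $n_0=n_0(F)$, depending only on $F$, such that for all integers $p\ge 2$ and $n\ge n_0$ $$\mathrm{ex}_p(n,F)=e_p(H(n,F)),$$ and $H(n,F)$ is, up to isomorphism, the unique extremal graph. In particular, if $F=kP_\ell$ is the disjoint union of $k$ copies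 of $P_\ell$, where $k\ge2$, $\ell\ge 2$ and $\ell\ne 3$, then there is $n_0=n_0(k,\ell)$ such that for all integers $p\ge 2$ and $n\ge n_0$ we have $\mathrm{ex}_p(n,kP_\ell)=e_p(H(n,kP_\ell))$, and $H(n,kP_\ell)$ is, up to isomorphism, the unique extremal graph. -/

import Mathlib

/-- The disjoint union of a family of graphs. -/
def disjointUnionGraph {ι : Type*} {V : ι → Type*} (G : ∀ i, SimpleGraph (V i)) :
    SimpleGraph (Σ i, V i) where
  Adj x y := ∃ (i : ι) (a b : V i), x = ⟨i, a⟩ ∧ y = ⟨i, b⟩ ∧ (G i).Adj a b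
  symm := ⟨by
    rintro x y ⟨i, a, b, hx, hy, h⟩
    exact ⟨i, b, a, hy, hx, h.symm⟩⟩
  loopless := ⟨by
    rintro x ⟨i, a, b, hx, hy, h⟩
    subst hx
    have hab : a = b := eq_of_heq (Sigma.mk.inj hy).2
    exact h.ne hab⟩

/-- The linear forest `P_{ℓ 0} ∪ ⋯ ∪ P_{ℓ (k-1)}`, where `P_m` is the path on `m` vertices. -/
def linearForest {k : ℕ} (l : Fin k → ℕ) : SimpleGraph (Σ i, Fin (l i)) :=
  disjointUnionGraph fun i => SimpleGraph.pathGraph (l i)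

/-- The join `G + H`: the disjoint union together with all edges between the two parts. -/
def joinGraph {V W : Type*} (G : SimpleGraph V) (H : SimpleGraph W) : SimpleGraph (V ⊕ W) where
  Adj
    | Sum.inl u, Sum.inl v => G.Adj u v
    | Sum.inr u, Sum.inr v => H.Adj u v
    | Sum.inl _, Sum.inr _ => True
    | Sum.inr _, Sum.inl _ => True
  symm := ⟨by
    rintro (u | u) (v | v) h
    · exact SimpleGraph.Adj.symm h
    · trivial
    · trivial
    · exact SimpleGraph.Adj.symm h⟩
  loopless := ⟨by
    rintro (u | u) h
    · exact G.irrefl h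
    · exact H.irrefl h⟩

/-- The graph on `m` vertices whose only edge joins the vertices `0` and `1`
(for `m ≥ 2`; for `m ≤ 1` there are no edges). -/
def singleEdgeGraph (m : ℕ) : SimpleGraph (Fin m) where
  Adj u v := (u.val = 0 ∧ v.val = 1) ∨ (u.val = 1 ∧ v.val = 0)
  symm := ⟨by rintro u v h; omega⟩
  loopless := ⟨by rintro u h; omega⟩

/-- The number `b = ∑ ⌊ℓ_i / 2⌋ - 1`. -/
def forestParam {k : ℕ} (l : Fin k → ℕ) : ℕ := (∑ i, l i / 2) - 1

open Classical in
/-- The graph `H(n, F)` for the linear forest `F` with path orders `ℓ_i`: the join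
`K_b + E_{n-b}`, with a single edge added to the empty part if all `ℓ_i` are odd.
It has `n` vertices whenever `b ≤ n`. -/
noncomputable def extremalH (n : ℕ) {k : ℕ} (l : Fin k → ℕ) :
    SimpleGraph (Fin (forestParam l) ⊕ Fin (n - forestParam l)) :=
  joinGraph (⊤ : SimpleGraph (Fin (forestParam l)))
    (if ∀ i, Odd (l i) then singleEdgeGraph (n - forestParam l) else ⊥)

open Classical in
/-- `e_p(G)`, the sum of the `p`-th powers of the degrees of `G`. -/
noncomputable def degreePowerSum (p : ℕ) {V : Type*} [Fintype V] (G : SimpleGraph V) : ℕ :=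
  ∑ v, G.degree v ^ p

open Classical in
/-- `ex_p(n, F)`, the maximum of `e_p(G)` over all graphs `G` on `n` vertices that do not contain
`F` as a (not necessarily induced) subgraph. -/
noncomputable def exPow (p n : ℕ) {W : Type*} (F : SimpleGraph W) : ℕ :=
  (Finset.univ.filter fun G : SimpleGraph (Fin n) => F.Free G).sup fun G => degreePowerSum p G

/-- `G` is an extremal graph for `ex_p(n, F)`: it is `F`-free and `e_p(G) = ex_p(n, F)`. -/
def IsExtremalPow (p n : ℕ) {W : Type*} (F : SimpleGraph W) (G : SimpleGraph (Fin n)) : Prop :=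
  F.Free G ∧ degreePowerSum p G = exPow p n F

/-!
Let `A` be a set of `b = ∑ ⌊ℓ_i / 2⌋ - 1` vertices that is completely joined to a large set `W`. Such
a bipartite graph is just too small to contain `F`: a path `P_ℓ` that alternates between the two
sides uses `⌊ℓ / 2⌋` vertices of `A`, so `F` needs `b + 1` of them. The proof shows that an `F`-free
graph with a large degree-power sum must have this shape, and then that `H(n, F)` is the best one.

*Location of `A`* (`exists_dominating_set`). Let `N = n - 1`, the largest possible degree. If
`e_p(G) ≥ e_p(H(n, F))`, then `∑ d ^ p ≥ b N ^ p`, whence `∑ d ^ 2 ≥ b N ^ 2`; passing to squares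
makes all bounds uniform in `p`. An `F`-free graph is degenerate, so it has `O(n)` edges and boundedly
many vertices of degree at least `ε n`. The degrees of these sum to at most `b N + O(1)`, because
`b + 1` vertices with many common neighbours already yield `F` (`sum_degree_le_of_free`). With
`x = d / N ∈ [0, 1]`, the sums `∑ x` and `∑ x ^ 2` both nearly equal `b`, so `∑ x (1 - x)` is tiny and
`b` vertices have nearly full degree while all others have small degree.

*Edges outside `A`* (`not_adj_outside_of_even`, `eq_or_eq_of_adj_outside`). Let `W` be the set of
vertices outside `A` adjacent to all of `A`, and let `R` be the rest outside `A`. If some `ℓ_i` is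
even, an edge outside `A` that meets `W` can begin the path `P_{ℓ_i}` and saves the missing vertex of
`A`. If all `ℓ_i` are odd, a path on three vertices that ends in `W` has the same effect, and so do two
disjoint edges meeting `W`, provided that some `ℓ_i ≥ 5`; here the case of all `ℓ_i` equal to `3` is
excluded. Hence at most two vertices of `W` have neighbours outside `A`.

*Optimization* (`sum_degree_pow_lt`). If `R` is nonempty, the edges missing between `A` and `R` cost at
least `#R * N ^ (p - 1)`, whereas the edges outside `A` span a set of size `O(#R)` in which all degrees
are small, and gain less than that. So `R` is empty and `G` is a spanning subgraph of `H(n, F)`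
(`exists_equiv_extremalH`), with equal degree-power sum only if the two are isomorphic. Finally
`H(n, F)` is `F`-free, as a path `P_ℓ` in it meets the complete part in at least `⌊ℓ / 2⌋` vertices
(`le_card_isLeft`).
-/

namespace LinearForestExtremal

open Finset

open scoped Classical

/-! ### Linear forests in complete bipartite graphs -/

section

variable {V : Type*} {G : SimpleGraph V}

/-- A path of `G`, encoded as the list of its vertices: consecutive vertices are adjacent and no
vertex is repeated. The number of vertices of the path is the length of the list. -/
def IsPathList (G : SimpleGraph V) (p : List V) : Prop :=
  p.IsChain G.Adj ∧ p.Nodup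

theorem IsPathList.take {p : List V} (hp : IsPathList G p) (n : ℕ) : IsPathList G (p.take n) :=
  ⟨hp.1.take n, hp.2.sublist (List.take_sublist n p)⟩

theorem IsPathList.cons {x y : V} {p : List V} (hp : IsPathList G (y :: p)) (hxy : G.Adj x y)
    (hx : x ∉ y :: p) : IsPathList G (x :: y :: p) :=
  ⟨List.isChain_cons_cons.2 ⟨hxy, hp.1⟩, List.nodup_cons.2 ⟨hx, hp.2⟩⟩

theorem isPathList_singleton (x : V) : IsPathList G [x] :=
  ⟨List.isChain_singleton x, List.nodup_singleton x⟩

theorem linearForest_adj {k : ℕ} {l : Fin k → ℕ} {x y : Σ i, Fin (l i)}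
    (h : (linearForest l).Adj x y) :
    ∃ (i : Fin k) (a b : Fin (l i)), x = ⟨i, a⟩ ∧ y = ⟨i, b⟩ ∧
      (a.val + 1 = b.val ∨ b.val + 1 = a.val) := by
  obtain ⟨i, a, b, hx, hy, hab⟩ := h
  exact ⟨i, a, b, hx, hy, SimpleGraph.pathGraph_adj.1 hab⟩

theorem isContained_of_pathLists {k : ℕ} {l : Fin k → ℕ} (P : Fin k → List V)
    (hP : ∀ i, IsPathList G (P i)) (hlen : ∀ i, (P i).length = l i)
    (hdisj : ∀ i j, i ≠ j → ∀ x ∈ P i, x ∉ P j) : (linearForest l).IsContained G := by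
  have hlt : ∀ x : (Σ i, Fin (l i)), x.2.val < (P x.1).length := fun x => by
    rw [hlen]; exact x.2.isLt
  refine ⟨⟨⟨fun x => (P x.1)[x.2.val]'(hlt x), ?_⟩, ?_⟩⟩
  · intro x y h
    obtain ⟨i, a, b, rfl, rfl, hab⟩ := linearForest_adj h
    have hc := List.isChain_iff_getElem.1 (hP i).1
    rcases hab with hab | hab
    · have := hc a.val (by rw [hlen]; omega)
      simpa [hab] using this
    · have := hc b.val (by rw [hlen]; omega)
      simpa [hab] using this.symm
  · rintro ⟨i, a⟩ ⟨j, b⟩ h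
    change (P i)[a.val]'(hlt ⟨i, a⟩) = (P j)[b.val]'(hlt ⟨j, b⟩) at h
    by_cases hij : i = j
    · subst hij
      have := ((hP i).2.getElem_inj_iff).1 h
      rw [Fin.ext this]
    · exact absurd (h ▸ List.getElem_mem _) (hdisj i j hij _ (List.getElem_mem (hlt ⟨i, a⟩)))

/-- A linear forest is a spanning subgraph of the path obtained by concatenating its components. -/
theorem isContained_of_isPathList {k : ℕ} {l : Fin k → ℕ} {p : List V} (hp : IsPathList G p)
    (hlen : p.length = ∑ i, l i) : (linearForest l).IsContained G := by
  refine ⟨⟨⟨fun x => p[(finSigmaFinEquiv x).val]'(by rw [hlen]; exact Fin.isLt _), ?_⟩, ?_⟩⟩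
  · intro x y h
    obtain ⟨i, a, b, rfl, rfl, hab⟩ := linearForest_adj h
    have hc := List.isChain_iff_getElem.1 hp.1
    have ha := finSigmaFinEquiv_apply (n := l) ⟨i, a⟩
    have hb := finSigmaFinEquiv_apply (n := l) ⟨i, b⟩
    have ha' := (finSigmaFinEquiv (n := l) ⟨i, a⟩).isLt
    have hb' := (finSigmaFinEquiv (n := l) ⟨i, b⟩).isLt
    simp only at ha hb
    rcases hab with hab | hab
    · have e : (finSigmaFinEquiv (n := l) ⟨i, b⟩).val =
        (finSigmaFinEquiv (n := l) ⟨i, a⟩).val + 1 := by omega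
      have := hc (finSigmaFinEquiv (n := l) ⟨i, a⟩).val (by omega)
      simpa only [e] using this
    · have e : (finSigmaFinEquiv (n := l) ⟨i, a⟩).val =
        (finSigmaFinEquiv (n := l) ⟨i, b⟩).val + 1 := by omega
      have := hc (finSigmaFinEquiv (n := l) ⟨i, b⟩).val (by omega)
      simpa only [e] using this.symm
  · intro x y h
    have := (hp.2.getElem_inj_iff).1 h
    exact finSigmaFinEquiv.injective (Fin.ext this)

/-- If `A` is completely joined to `W`, a path whose first vertex is adjacent to all of `A` can be
prolonged at that end by `s` vertices of `A` and `s` vertices of `W`, alternately. The sets `A'` and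
`W'` collect the vertices that stay unused. -/
theorem exists_prolongation {A W : Finset V} (hAW : ∀ a ∈ A, ∀ w ∈ W, G.Adj a w)
    {w : V} {q : List V}
    (hq : IsPathList G (w :: q)) (hw : ∀ a ∈ A, G.Adj a w)
    (hqA : ∀ x ∈ w :: q, x ∉ A ∧ x ∉ W) {s : ℕ} (hsA : s ≤ #A) (hsW : s ≤ #W) :
    ∃ (w' : V) (p : List V) (A' W' : Finset V), IsPathList G (w' :: p) ∧
      p.length = q.length + 2 * s ∧ (∀ a ∈ A', G.Adj a w') ∧ A' ⊆ A ∧ W' ⊆ W ∧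
      #A' + s = #A ∧ #W' + s = #W ∧
      ∀ x ∈ w' :: p, (x ∈ w :: q ∨ x ∈ A ∨ x ∈ W) ∧ x ∉ A' ∧ x ∉ W' := by
  induction s with
  | zero =>
    exact ⟨w, q, A, W, hq, rfl, hw, Subset.rfl, Subset.rfl, rfl, rfl,
      fun x hx => ⟨Or.inl hx, hqA x hx⟩⟩
  | succ s ih =>
    obtain ⟨u, p, A', W', hp, hlen, hu, hA', hW', cA, cW, hmem⟩ := ih (by omega) (by omega)
    obtain ⟨a, ha⟩ : A'.Nonempty := card_pos.1 (by omega)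
    obtain ⟨v, hv⟩ : W'.Nonempty := card_pos.1 (by omega)
    have hav : G.Adj a v := hAW a (hA' ha) v (hW' hv)
    have ha' : a ∉ u :: p := fun h => (hmem a h).2.1 ha
    have hv' : v ∉ a :: u :: p := by
      rw [List.mem_cons, not_or]
      exact ⟨hav.ne', fun h => (hmem v h).2.2 hv⟩
    refine ⟨v, a :: u :: p, A'.erase a, W'.erase v, (hp.cons (hu a ha) ha').cons hav.symm hv',
      by simp only [List.length_cons]; omega,
      fun a' h => hAW a' (hA' (mem_of_mem_erase h)) v (hW' hv),
      (erase_subset _ _).trans hA', (erase_subset _ _).trans hW',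
      by rw [card_erase_of_mem ha]; have := card_pos.2 ⟨a, ha⟩; omega,
      by rw [card_erase_of_mem hv]; have := card_pos.2 ⟨v, hv⟩; omega, ?_⟩
    intro x hx
    rw [List.mem_cons, List.mem_cons] at hx
    rcases hx with rfl | rfl | hx
    · refine ⟨Or.inr (Or.inr (hW' hv)), fun h => ?_, notMem_erase _ _⟩
      exact (hAW x (hA' (mem_of_mem_erase h)) x (hW' hv)).ne rfl
    · refine ⟨Or.inr (Or.inl (hA' ha)), notMem_erase _ _, fun h => ?_⟩
      exact (hAW x (hA' ha) x (hW' (mem_of_mem_erase h))).ne rfl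
    · obtain ⟨h1, h2, h3⟩ := hmem x hx
      exact ⟨h1, fun h => h2 (mem_of_mem_erase h), fun h => h3 (mem_of_mem_erase h)⟩

/-- A complete bipartite graph with parts `A` and `W` contains every linear forest with
`∑ ⌊ℓ_i / 2⌋ ≤ #A`, provided that `W` is large. -/
theorem exists_disjoint_pathLists {ι : Type*} (l : ι → ℕ) (S : Finset ι) :
    ∀ {A W : Finset V}, (∀ a ∈ A, ∀ w ∈ W, G.Adj a w) → ∑ i ∈ S, l i / 2 ≤ #A →
      ∑ i ∈ S, (l i / 2 + 1) ≤ #W →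
      ∃ P : ι → List V, (∀ i ∈ S, IsPathList G (P i) ∧ (P i).length = l i ∧
        ∀ x ∈ P i, x ∈ A ∨ x ∈ W) ∧
        ∀ i ∈ S, ∀ j ∈ S, i ≠ j → ∀ x ∈ P i, x ∉ P j := by
  induction S using Finset.induction_on with
  | empty => intro A W _ _ _; exact ⟨fun _ => [], by simp, by simp⟩
  | insert i S hi ih =>
    intro A W hAW cA cW
    rw [sum_insert hi] at cA cW
    obtain ⟨w, hw⟩ : W.Nonempty := card_pos.1 (by omega)
    have cW' : #(W.erase w) + 1 = #W := by
      rw [card_erase_of_mem hw]; have := card_pos.2 ⟨w, hw⟩; omega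
    obtain ⟨u, p, A', W', hp, hlen, -, hA', hW', cA', cW'', hmem⟩ :=
      exists_prolongation (A := A) (W := W.erase w) (w := w) (q := []) (s := l i / 2)
        (fun a ha v hv => hAW a ha v (mem_of_mem_erase hv)) (isPathList_singleton w)
        (fun a ha => hAW a ha w hw)
        (by
          intro x hx
          rw [List.mem_singleton] at hx
          subst hx
          exact ⟨fun h => (hAW x h x hw).ne rfl, notMem_erase _ _⟩) (by omega) (by omega)
    have hW'' : W' ⊆ W := hW'.trans (erase_subset _ _)
    obtain ⟨P, hP, hPd⟩ := ih (A := A') (W := W')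
      (fun a ha v hv => hAW a (hA' ha) v (hW'' hv)) (by omega) (by omega)
    have hnew : ∀ x ∈ (u :: p).take (l i), (x ∈ A ∨ x ∈ W) ∧ x ∉ A' ∧ x ∉ W' := by
      intro x hx
      obtain ⟨h1, h2⟩ := hmem x (List.mem_of_mem_take hx)
      refine ⟨?_, h2⟩
      rcases h1 with h1 | h1 | h1
      · rw [List.mem_singleton] at h1
        exact Or.inr (h1 ▸ hw)
      · exact Or.inl h1
      · exact Or.inr (mem_of_mem_erase h1)
    have hne : ∀ j ∈ S, j ≠ i := fun j hj h => hi (h ▸ hj)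
    refine ⟨Function.update P i ((u :: p).take (l i)), ?_, ?_⟩
    · intro j hj
      rcases mem_insert.1 hj with rfl | hj
      · rw [Function.update_self]
        refine ⟨hp.take _, ?_, fun x hx => (hnew x hx).1⟩
        rw [List.length_take, List.length_cons, hlen, List.length_nil]
        omega
      · rw [Function.update_of_ne (hne j hj)]
        obtain ⟨h1, h2, h3⟩ := hP j hj
        exact ⟨h1, h2, fun x hx => (h3 x hx).imp (fun h => hA' h) (fun h => hW'' h)⟩
    · intro j hjm j' hjm' hjj' x hx
      rcases mem_insert.1 hjm with rfl | hj <;> rcases mem_insert.1 hjm' with rfl | hj'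
      · exact absurd rfl hjj'
      · rw [Function.update_self] at hx
        rw [Function.update_of_ne (hne j' hj')]
        intro hx'
        rcases (hP j' hj').2.2 x hx' with h | h
        · exact (hnew x hx).2.1 h
        · exact (hnew x hx).2.2 h
      · rw [Function.update_of_ne (hne j hj)] at hx
        rw [Function.update_self]
        intro hx'
        rcases (hP j hj).2.2 x hx with h | h
        · exact (hnew x hx').2.1 h
        · exact (hnew x hx').2.2 h
      · rw [Function.update_of_ne (hne j hj)] at hx
        rw [Function.update_of_ne (hne j' hj')]
        exact hPd j hj j' hj' hjj' x hx

theorem isContained_of_complete {k : ℕ} {l : Fin k → ℕ} {A W : Finset V}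
    (hAW : ∀ a ∈ A, ∀ w ∈ W, G.Adj a w) (cA : ∑ i, l i / 2 ≤ #A)
    (cW : ∑ i, (l i / 2 + 1) ≤ #W) : (linearForest l).IsContained G := by
  obtain ⟨P, hP, hd⟩ := exists_disjoint_pathLists l univ hAW cA cW
  exact isContained_of_pathLists P (fun i => (hP i (mem_univ i)).1)
    (fun i => (hP i (mem_univ i)).2.1) fun i j h => hd i (mem_univ i) j (mem_univ j) h

/-- One component of the linear forest is given as a path `p`; the others are found in the complete
bipartite graph between the remaining vertices. -/
theorem isContained_of_complete_of_isPathList {k : ℕ} {l : Fin k → ℕ} {A W : Finset V}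
    (hAW : ∀ a ∈ A, ∀ w ∈ W, G.Adj a w) (i : Fin k) {p : List V} (hp : IsPathList G p)
    (hlen : p.length = l i) (hmem : ∀ x ∈ p, x ∉ A ∧ x ∉ W)
    (cA : ∑ i, l i / 2 ≤ #A + l i / 2) (cW : ∑ i, (l i / 2 + 1) ≤ #W) :
    (linearForest l).IsContained G := by
  have e1 := add_sum_erase univ (fun i => l i / 2) (mem_univ i)
  have e2 := add_sum_erase univ (fun i => l i / 2 + 1) (mem_univ i)
  obtain ⟨P, hP, hd⟩ := exists_disjoint_pathLists l (univ.erase i) hAW (by omega) (by omega)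
  have hS : ∀ j, j ≠ i → j ∈ univ.erase i := fun j hj => mem_erase.2 ⟨hj, mem_univ j⟩
  have hav : ∀ j, j ≠ i → ∀ x ∈ P j, x ∉ p := by
    intro j hj x hx hx'
    rcases (hP j (hS j hj)).2.2 x hx with h | h
    · exact (hmem x hx').1 h
    · exact (hmem x hx').2 h
  refine isContained_of_pathLists (Function.update P i p) ?_ ?_ ?_
  · intro j
    by_cases hj : j = i
    · subst hj; rwa [Function.update_self]
    · rw [Function.update_of_ne hj]; exact (hP j (hS j hj)).1
  · intro j
    by_cases hj : j = i
    · subst hj; rwa [Function.update_self]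
    · rw [Function.update_of_ne hj]; exact (hP j (hS j hj)).2.1
  · intro j j' hjj' x hx
    by_cases hj : j = i
    · subst hj
      rw [Function.update_self] at hx
      rw [Function.update_of_ne hjj'.symm]
      exact fun h => hav j' hjj'.symm x h hx
    · rw [Function.update_of_ne hj] at hx
      by_cases hj' : j' = i
      · subst hj'
        rw [Function.update_self]
        exact hav j hj x hx
      · rw [Function.update_of_ne hj']
        exact hd j (hS j hj) j' (hS j' hj') hjj' x hx

end

/-! ### Sparsity, and the vertices of large degree -/

section

variable {V : Type*} {G : SimpleGraph V}

/-- If all degrees inside `S` exceed `m`, a path in `S` can be grown greedily. -/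
theorem exists_isPathList_of_minDegree {S : Finset V} (hS : S.Nonempty) {m : ℕ}
    (hdeg : ∀ v ∈ S, m < #{u ∈ S | G.Adj v u}) : ∃ p, IsPathList G p ∧ p.length = m := by
  have key : ∀ j ≤ m, ∃ (x : V) (q : List V), IsPathList G (x :: q) ∧ q.length = j ∧
      ∀ y ∈ x :: q, y ∈ S := by
    intro j
    induction j with
    | zero =>
      intro _
      obtain ⟨x, hx⟩ := hS
      exact ⟨x, [], isPathList_singleton x, rfl, by simpa using hx⟩
    | succ j ih =>
      intro hj
      obtain ⟨x, q, hq, hlen, hmem⟩ := ih (by omega)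
      have h1 : #(x :: q).toFinset < #{u ∈ S | G.Adj x u} := by
        have h2 := List.toFinset_card_le (x :: q)
        rw [List.length_cons, hlen] at h2
        have h3 := hdeg x (hmem x List.mem_cons_self)
        omega
      obtain ⟨y, hy, hy'⟩ := exists_mem_notMem_of_card_lt_card h1
      rw [mem_filter] at hy
      rw [List.mem_toFinset] at hy'
      refine ⟨y, x :: q, hq.cons hy.2.symm hy', by rw [List.length_cons, hlen], ?_⟩
      intro z hz
      rcases List.mem_cons.1 hz with rfl | hz
      · exact hy.1
      · exact hmem z hz
  obtain ⟨x, q, hq, hlen, -⟩ := key m le_rfl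
  exact ⟨(x :: q).take m, hq.take m, by rw [List.length_take, List.length_cons]; omega⟩

/-- A graph without a path on `m` vertices is `m`-degenerate, so each vertex set `S` spans at most
`m * #S` edges. -/
theorem sum_degree_within_le {m : ℕ} (hno : ∀ p, IsPathList G p → p.length ≠ m) (S : Finset V) :
    ∑ v ∈ S, #{u ∈ S | G.Adj v u} ≤ 2 * m * #S := by
  induction S using Finset.strongInduction with
  | H S ih =>
    rcases S.eq_empty_or_nonempty with rfl | hS
    · simp
    obtain ⟨v, hv, hvm⟩ : ∃ v ∈ S, #{u ∈ S | G.Adj v u} ≤ m := by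
      by_contra! h
      obtain ⟨p, hp, hlen⟩ := exists_isPathList_of_minDegree hS h
      exact hno p hp hlen
    have h1 := ih (S.erase v) (erase_ssubset hv)
    have h2 : ∀ w ∈ S.erase v, #{u ∈ S | G.Adj w u} =
        #{u ∈ S.erase v | G.Adj w u} + if G.Adj v w then 1 else 0 := by
      intro w _
      conv_lhs => rw [← insert_erase hv]
      rw [filter_insert, G.adj_comm w v]
      split_ifs
      · rw [card_insert_of_notMem (by simp)]
      · rfl
    have h3 : #{w ∈ S.erase v | G.Adj v w} ≤ #{u ∈ S | G.Adj v u} :=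
      card_le_card (filter_subset_filter _ (erase_subset _ _))
    rw [← add_sum_erase S _ hv, sum_congr rfl h2, sum_add_distrib, ← card_filter]
    have h4 : #(S.erase v) + 1 = #S := card_erase_add_one hv
    rw [← h4]
    linarith

variable [Fintype V]

theorem degree_eq_card_filter (v : V) : G.degree v = #{u | G.Adj v u} := by
  rw [← SimpleGraph.card_neighborFinset_eq_degree]
  congr 1
  ext u
  simp

/-- Vertices of `B` have few edges in total: a vertex with more than `b` neighbours in `B` is one of
few exceptions, since any set of `b + 1` vertices has few common neighbours. -/
theorem sum_degree_le_of_free {k : ℕ} {l : Fin k → ℕ} (hF : (linearForest l).Free G)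
    (B : Finset V) {b β : ℕ} (hb : ∑ i, l i / 2 = b + 1) (hβ : #B ≤ β) :
    ∑ v ∈ B, G.degree v ≤
      b * Fintype.card V + (∑ i, (l i / 2 + 1)) * 2 ^ β * β := by
  set c := ∑ i, (l i / 2 + 1)
  have h1 : ∑ v ∈ B, G.degree v = ∑ u : V, #{v ∈ B | G.Adj u v} := by
    simp_rw [degree_eq_card_filter]
    refine (sum_card_bipartiteAbove_eq_sum_card_bipartiteBelow (s := B) (t := univ) G.Adj).trans ?_
    refine sum_congr rfl fun u _ => ?_
    simp [bipartiteBelow, G.adj_comm]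
  set X : Finset V := {u | b < #{v ∈ B | G.Adj u v}}
  have hX : #X ≤ c * #(B.powerset) := by
    refine card_le_mul_card_image_of_maps_to (f := fun u => {v ∈ B | G.Adj u v})
      (fun u _ => mem_powerset.2 (filter_subset _ _)) c ?_
    intro C _
    by_contra! hc
    have hne : ({u ∈ X | ({v ∈ B | G.Adj u v} : Finset V) = C}).Nonempty := card_pos.1 (by omega)
    obtain ⟨u, hu⟩ := hne
    refine hF (isContained_of_complete (A := C)
      (W := {u ∈ X | ({v ∈ B | G.Adj u v} : Finset V) = C}) ?_ ?_ hc.le)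
    · intro a ha w hw
      rw [← (mem_filter.1 hw).2] at ha
      exact (mem_filter.1 ha).2.symm
    · rw [hb, ← (mem_filter.1 hu).2]
      exact (mem_filter.1 (mem_filter.1 hu).1).2
  rw [card_powerset] at hX
  have hX' : #X ≤ c * 2 ^ β :=
    hX.trans (Nat.mul_le_mul_left _ (Nat.pow_le_pow_right (by norm_num) hβ))
  rw [h1]
  calc ∑ u : V, #{v ∈ B | G.Adj u v}
      ≤ ∑ u : V, (b + if u ∈ X then β else 0) := by
        refine sum_le_sum fun u _ => ?_
        split_ifs with hu
        · exact ((card_le_card (filter_subset _ _)).trans hβ).trans (by omega)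
        · simp only [X, mem_filter, mem_univ, true_and, not_lt] at hu
          omega
    _ = b * Fintype.card V + #X * β := by
        rw [sum_add_distrib, sum_const, ← sum_filter, sum_const, card_univ, smul_eq_mul,
          smul_eq_mul, mul_comm b, filter_mem_eq_inter, univ_inter]
    _ ≤ _ := by gcongr

/-- If `x` takes values in `[0, 1]` and both `∑ x` and `∑ x ^ 2` are close to the integer `b`, then
`∑ x * (1 - x)` is small, so that `x` is close to `1` at exactly `b` points and close to `0` at all
others. -/
theorem exists_card_eq_of_sum_sq {ι : Type*} (B : Finset ι) (x : ι → ℝ) (b : ℕ) {δ : ℝ}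
    (hx0 : ∀ i ∈ B, 0 ≤ x i) (hx1 : ∀ i ∈ B, x i ≤ 1) (hδ : δ * (4 * b + 10) < 1)
    (h1 : ∑ i ∈ B, x i ≤ b + δ) (h2 : b - δ ≤ ∑ i ∈ B, x i ^ 2) :
    ∃ A ⊆ B, #A = b ∧ (∀ i ∈ A, 1 - 4 * δ ≤ x i) ∧ ∀ i ∈ B, i ∉ A → x i ≤ 4 * δ := by
  have hb0 : (0 : ℝ) ≤ b := b.cast_nonneg
  have h3 : ∀ i ∈ B, x i * (1 - x i) ≤ 2 * δ := by
    intro i hi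
    have hs : ∑ i ∈ B, x i * (1 - x i) ≤ 2 * δ := by
      have : ∑ i ∈ B, x i * (1 - x i) = ∑ i ∈ B, x i - ∑ i ∈ B, x i ^ 2 := by
        rw [← sum_sub_distrib]
        exact sum_congr rfl fun i _ => by ring
      linarith
    exact (single_le_sum (f := fun i => x i * (1 - x i))
      (fun j hj => mul_nonneg (hx0 j hj) (by linarith [hx1 j hj])) hi).trans hs
  have hδ0 : 0 ≤ δ := by
    have : ∑ i ∈ B, x i ^ 2 ≤ ∑ i ∈ B, x i :=
      sum_le_sum fun i hi => by nlinarith [hx0 i hi, hx1 i hi]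
    linarith
  have hA : ∀ i ∈ B.filter (fun i => 1 / 2 < x i), 1 - 4 * δ ≤ x i := by
    intro i hi
    obtain ⟨hi, hx⟩ := mem_filter.1 hi
    nlinarith [h3 i hi, hx1 i hi]
  have hA' : ∀ i ∈ B.filter (fun i => ¬ 1 / 2 < x i), x i ≤ 4 * δ := by
    intro i hi
    obtain ⟨hi, hx⟩ := mem_filter.1 hi
    nlinarith [h3 i hi, hx0 i hi]
  have hs1 := sum_filter_add_sum_filter_not B (fun i => 1 / 2 < x i) x
  have hs2 := sum_filter_add_sum_filter_not B (fun i => 1 / 2 < x i) (fun i => x i ^ 2)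
  set A := B.filter (fun i => 1 / 2 < x i) with hAdef
  set A' := B.filter (fun i => ¬ 1 / 2 < x i)
  have hA'0 : 0 ≤ ∑ i ∈ A', x i := sum_nonneg fun i hi => hx0 i (filter_subset _ _ hi)
  have hA0 : 0 ≤ ∑ i ∈ A, x i := sum_nonneg fun i hi => hx0 i (filter_subset _ _ hi)
  have hup : (#A : ℝ) * (1 - 4 * δ) ≤ ∑ i ∈ A, x i := by
    rw [← nsmul_eq_mul]; exact card_nsmul_le_sum _ _ _ hA
  have hlow1 : ∑ i ∈ A, x i ^ 2 ≤ #A := by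
    have : ∑ i ∈ A, x i ^ 2 ≤ ∑ i ∈ A, (1 : ℝ) := sum_le_sum fun i hi => by
      nlinarith [hx0 i (filter_subset _ _ hi), hx1 i (filter_subset _ _ hi)]
    simpa using this
  have hlow2 : ∑ i ∈ A', x i ^ 2 ≤ 4 * δ * ∑ i ∈ A', x i := by
    rw [mul_sum]
    exact sum_le_sum fun i hi => by
      nlinarith [hA' i hi, hx0 i (filter_subset _ _ hi)]
  have hδ1 : δ < 1 / 10 := by nlinarith
  have hlt : (#A : ℝ) < b + 1 := by
    by_contra! h
    nlinarith
  have hgt : (b : ℝ) < #A + 1 := by nlinarith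
  have hcard : #A = b := by
    have h4 : #A < b + 1 := by exact_mod_cast hlt
    have h5 : b < #A + 1 := by exact_mod_cast hgt
    omega
  refine ⟨A, filter_subset _ _, hcard, hA, fun i hi hiA => hA' i (mem_filter.2 ⟨hi, ?_⟩)⟩
  exact fun h => hiA (mem_filter.2 ⟨hi, h⟩)

/-- A large `F`-free graph whose degree-square sum is at least `b (n - 1) ^ 2` has `b` vertices that
are adjacent to almost all vertices, and all other degrees are small. -/
theorem exists_dominating_set {k : ℕ} (l : Fin k → ℕ) {b : ℕ} (hb : ∑ i, l i / 2 = b + 1)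
    {q : ℕ} (hq : 0 < q) : ∃ n₀ : ℕ, ∀ (V : Type) [Fintype V] (G : SimpleGraph V) (N : ℕ),
      Fintype.card V = N + 1 → n₀ ≤ N → (linearForest l).Free G →
      b * N ^ 2 ≤ ∑ v, G.degree v ^ 2 →
      ∃ A : Finset V, #A = b ∧ (∀ v ∈ A, q * N ≤ q * G.degree v + N) ∧
        ∀ v, v ∉ A → q * G.degree v ≤ N := by
  set m := ∑ i, l i with hm
  -- `1 / D` is the tolerance `δ` in `exists_card_eq_of_sum_sq`.
  set D := 4 * q + 4 * b + 11 with hD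
  -- Vertices of degree at least `N / Q` are the candidates for `A`.
  set Q := 4 * m * D + q with hQ
  set β := 4 * m * Q with hβ
  set K := b + (∑ i, (l i / 2 + 1)) * 2 ^ β * β with hK
  refine ⟨K * D + 1, fun V _ G N hn hN hF hsq => ?_⟩
  have hN0 : 0 < N := by omega
  have hno : ∀ p, IsPathList G p → p.length ≠ m := fun p hp hlen =>
    hF (isContained_of_isPathList hp hlen)
  have hdN : ∀ v, G.degree v ≤ N := fun v => by
    have := G.degree_lt_card_verts v; omega
  have hsum : ∑ v, G.degree v ≤ 4 * m * N := by
    have := sum_degree_within_le hno univ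
    simp_rw [← degree_eq_card_filter, card_univ, hn] at this
    nlinarith
  set B : Finset V := {v | N ≤ Q * G.degree v} with hB
  have hBβ : #B ≤ β := by
    have h1 : #B * N ≤ Q * ∑ v, G.degree v := by
      rw [← smul_eq_mul, mul_sum]
      refine (card_nsmul_le_sum B (fun v => Q * G.degree v) N fun v hv => (mem_filter.1 hv).2).trans
        (sum_le_sum_of_subset (subset_univ _))
    have h2 : #B * N ≤ β * N := by nlinarith
    exact Nat.le_of_mul_le_mul_right h2 hN0
  have hsB := sum_degree_le_of_free hF B hb hBβ
  have hsB' : ∑ v ∈ B, G.degree v ≤ b * N + K := by rw [hn] at hsB; rw [hK]; linarith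
  have hNr : (0 : ℝ) < N := by exact_mod_cast hN0
  have hDr : (0 : ℝ) < D := by rw [hD]; positivity
  have hQr : (0 : ℝ) < Q := by rw [hQ]; exact_mod_cast (by omega)
  have hlow : Q * ∑ v ∈ Bᶜ, G.degree v ^ 2 ≤ N * (4 * m * N) := by
    calc Q * ∑ v ∈ Bᶜ, G.degree v ^ 2 = ∑ v ∈ Bᶜ, Q * G.degree v * G.degree v := by
          rw [mul_sum]; exact sum_congr rfl fun v _ => by ring
      _ ≤ ∑ v ∈ Bᶜ, N * G.degree v := by
          refine sum_le_sum fun v hv => Nat.mul_le_mul_right _ ?_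
          rw [mem_compl, hB, mem_filter] at hv
          simp only [mem_univ, true_and, not_le] at hv
          exact hv.le
      _ ≤ N * ∑ v, G.degree v := by
          rw [← mul_sum]; exact Nat.mul_le_mul_left _ (sum_le_sum_of_subset (subset_univ _))
      _ ≤ _ := Nat.mul_le_mul_left _ hsum
  obtain ⟨A, hAB, hAb, hA1, hA2⟩ := exists_card_eq_of_sum_sq B (fun v => (G.degree v : ℝ) / N) b
    (δ := 1 / D) (fun v _ => by positivity)
    (fun v _ => by rw [div_le_one hNr]; exact_mod_cast hdN v)
    (by
      rw [one_div, inv_mul_lt_iff₀ hDr, hD]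
      push_cast
      linarith [(Nat.cast_nonneg q : (0 : ℝ) ≤ q)])
    (by
      rw [← sum_div, div_le_iff₀ hNr]
      have h1 : (∑ v ∈ B, (G.degree v : ℝ)) ≤ b * N + K := by exact_mod_cast hsB'
      have h2 : (K : ℝ) ≤ 1 / D * N := by
        rw [one_div, inv_mul_eq_div, le_div_iff₀ hDr]
        exact_mod_cast (by omega : K * D ≤ N)
      linarith)
    (by
      simp_rw [div_pow]
      rw [← sum_div, le_div_iff₀ (by positivity)]
      have h1 : (b : ℝ) * N ^ 2 ≤ ∑ v ∈ B, (G.degree v : ℝ) ^ 2 + ∑ v ∈ Bᶜ, (G.degree v : ℝ) ^ 2 := by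
        rw [sum_add_sum_compl]; exact_mod_cast hsq
      have h2 : (Q : ℝ) * ∑ v ∈ Bᶜ, (G.degree v : ℝ) ^ 2 ≤ N * (4 * m * N) := by
        exact_mod_cast hlow
      have h3 : (4 * m * D : ℝ) ≤ Q := by
        rw [hQ]
        push_cast
        linarith [(Nat.cast_nonneg q : (0 : ℝ) ≤ q)]
      have h4 : ∑ v ∈ Bᶜ, (G.degree v : ℝ) ^ 2 ≤ 1 / D * N ^ 2 := by
        rw [one_div, inv_mul_eq_div, le_div_iff₀ hDr]
        refine le_of_mul_le_mul_left ?_ hQr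
        have h5 := mul_le_mul_of_nonneg_right h2 hDr.le
        have h6 := mul_le_mul_of_nonneg_right h3 (sq_nonneg (N : ℝ))
        nlinarith
      linarith)
  have h4D : (4 : ℝ) * (1 / D) * q ≤ 1 := by
    rw [mul_one_div, div_mul_eq_mul_div, div_le_one hDr, hD]
    push_cast; linarith [(Nat.cast_nonneg b : (0 : ℝ) ≤ b)]
  have hqr : (0 : ℝ) < q := by exact_mod_cast hq
  refine ⟨A, hAb, fun v hv => ?_, fun v hv => ?_⟩
  · have h := hA1 v hv
    rw [le_div_iff₀ hNr] at h
    have h' : (q : ℝ) * N ≤ q * G.degree v + N := by nlinarith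
    exact_mod_cast h'
  · by_cases hvB : v ∈ B
    · have h := hA2 v hvB hv
      rw [div_le_iff₀ hNr] at h
      have h' : (q : ℝ) * G.degree v ≤ N := by nlinarith
      exact_mod_cast h'
    · rw [hB, mem_filter] at hvB
      simp only [mem_univ, true_and, not_le] at hvB
      exact (Nat.mul_le_mul_right _ (by omega : q ≤ Q)).trans hvB.le

end

/-! ### Edges outside the dominating set -/

section

variable {V : Type*} {G : SimpleGraph V}

/-- A component `ℓ_i` that only uses `⌊ℓ_i / 2⌋ - 1` vertices of `A`, because it starts with a path
outside `A`, makes up for the one vertex that `A` lacks. -/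
theorem isContained_of_path_outside {k : ℕ} {l : Fin k → ℕ} {A W : Finset V}
    (hAW : ∀ a ∈ A, ∀ w ∈ W, G.Adj a w) (cA : ∑ i, l i / 2 = #A + 1)
    (cW : 2 * ∑ i, (l i / 2 + 1) + 4 ≤ #W) {w : V} (hw : w ∈ W) {q : List V}
    (hq : IsPathList G (w :: q)) (hqA : ∀ x ∈ q, x ∉ A) (hq3 : q.length ≤ 3) {i : Fin k} {s : ℕ}
    (hl : q.length + 1 + 2 * s = l i) (hs : s + 1 = l i / 2) :
    (linearForest l).IsContained G := by
  have h1 := single_le_sum (f := fun i => l i / 2) (fun j _ => Nat.zero_le _) (mem_univ i)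
  have h2 := single_le_sum (f := fun i => l i / 2 + 1) (fun j _ => Nat.zero_le _) (mem_univ i)
  have h3 : #W ≤ #(W \ (w :: q).toFinset) + 4 := by
    have := le_card_sdiff (w :: q).toFinset W
    have := List.toFinset_card_le (w :: q)
    simp only [List.length_cons] at this
    omega
  obtain ⟨w', p, A', W', hp, hlen, -, hA', hW', cA', cW', hmem⟩ :=
    exists_prolongation (A := A) (W := W \ (w :: q).toFinset) (s := s)
      (fun a ha v hv => hAW a ha v (sdiff_subset hv)) hq (fun a ha => hAW a ha w hw)
      (by
        intro x hx
        refine ⟨?_, fun h => (mem_sdiff.1 h).2 (List.mem_toFinset.2 hx)⟩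
        rcases List.mem_cons.1 hx with rfl | hx
        · exact fun h => (hAW x h x hw).ne rfl
        · exact hqA x hx) (by omega) (by omega)
  exact isContained_of_complete_of_isPathList (A := A') (W := W')
    (fun a ha v hv => hAW a (hA' ha) v (sdiff_subset (hW' hv))) i hp
    (by rw [List.length_cons]; omega) (fun x hx => (hmem x hx).2) (by omega) (by omega)

/-- A component `P_ℓ` with `ℓ ≥ 5` odd can start and end with one of two disjoint edges that meet
`W`, and then uses only `⌊ℓ / 2⌋ - 1` vertices of `A`. -/
theorem isContained_of_two_edges_outside {k : ℕ} {l : Fin k → ℕ} {A W : Finset V}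
    (hAW : ∀ a ∈ A, ∀ w ∈ W, G.Adj a w) (cA : ∑ i, l i / 2 = #A + 1)
    (cW : 2 * ∑ i, (l i / 2 + 1) + 4 ≤ #W) {w x w' x' : V} (hw : w ∈ W) (hw' : w' ∈ W)
    (hx : x ∉ A) (hx' : x' ∉ A) (hwx : G.Adj w x) (hwx' : G.Adj w' x') (hww' : w ≠ w')
    (hxx' : x ≠ x') (h_wx' : w ≠ x') (h_xw' : x ≠ w') {i : Fin k} (hl : 5 ≤ l i)
    (hodd : Odd (l i)) : (linearForest l).IsContained G := by
  have h1 := single_le_sum (f := fun i => l i / 2) (fun j _ => Nat.zero_le _) (mem_univ i)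
  have h2 := single_le_sum (f := fun i => l i / 2 + 1) (fun j _ => Nat.zero_le _) (mem_univ i)
  obtain ⟨m, hm⟩ := hodd
  have hWA : ∀ v ∈ W, v ∉ A := fun v hv h => (hAW v h v hv).ne rfl
  have h3 : #W ≤ #(W \ {w, x, w', x'}) + 4 := by
    have := le_card_sdiff {w, x, w', x'} W
    have := card_le_four (a := w) (b := x) (c := w') (d := x')
    omega
  obtain ⟨u, p, A', W', hp, hlen, hu, hA', hW', cA', cW', hmem⟩ :=
    exists_prolongation (A := A) (W := W \ {w, x, w', x'}) (w := w') (q := [x']) (s := l i / 2 - 2)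
      (fun a ha v hv => hAW a ha v (sdiff_subset hv))
      ((isPathList_singleton x').cons hwx' (by simpa using hwx'.ne))
      (fun a ha => hAW a ha w' hw')
      (by
        intro y hy
        simp only [List.mem_cons, List.not_mem_nil, or_false] at hy
        rcases hy with rfl | rfl
        · exact ⟨hWA _ hw', by simp⟩
        · exact ⟨hx', by simp⟩) (by omega) (by omega)
  rw [List.length_singleton] at hlen
  obtain ⟨a, ha⟩ : A'.Nonempty := card_pos.1 (by omega)
  have hawx : ∀ y, (y = w ∨ y = x) → y ∉ u :: p := by
    intro y hy h
    have hyA : y ∉ A := by rcases hy with rfl | rfl; exacts [hWA _ hw, hx]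
    rcases (hmem y h).1 with h | h | h
    · simp only [List.mem_cons, List.not_mem_nil, or_false] at h
      rcases hy with rfl | rfl <;> rcases h with h | h <;> contradiction
    · exact hyA h
    · rcases hy with rfl | rfl <;> simp at h
  have haA := hA' ha
  have hwa : w ∉ a :: u :: p := by
    rw [List.mem_cons, not_or]
    exact ⟨(hAW a haA w hw).ne', hawx w (Or.inl rfl)⟩
  have hxwa : x ∉ w :: a :: u :: p := by
    rw [List.mem_cons, List.mem_cons, not_or, not_or]
    exact ⟨hwx.ne', fun h => hx (h ▸ haA), hawx x (Or.inr rfl)⟩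
  have hpath : IsPathList G (x :: w :: a :: u :: p) :=
    ((hp.cons (hu a ha) fun h => (hmem a h).2.1 ha).cons (hAW a haA w hw).symm hwa).cons
      hwx.symm hxwa
  have hca := card_erase_add_one ha
  refine isContained_of_complete_of_isPathList (A := A'.erase a) (W := W')
    (fun a ha v hv => hAW a (hA' (mem_of_mem_erase ha)) v (sdiff_subset (hW' hv))) i hpath
    (by simp only [List.length_cons]; omega) ?_ (by omega) (by omega)
  intro y hy
  rw [List.mem_cons, List.mem_cons, List.mem_cons] at hy
  rcases hy with rfl | rfl | rfl | hy
  · exact ⟨fun h => hx (hA' (mem_of_mem_erase h)), fun h => by simpa using hW' h⟩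
  · exact ⟨fun h => hWA _ hw (hA' (mem_of_mem_erase h)), fun h => by simpa using hW' h⟩
  · exact ⟨notMem_erase _ _, fun h => hWA _ (sdiff_subset (hW' h)) haA⟩
  · exact ⟨fun h => (hmem y hy).2.1 (mem_of_mem_erase h), (hmem y hy).2.2⟩

theorem not_adj_outside_of_even {k : ℕ} {l : Fin k → ℕ} (hF : (linearForest l).Free G)
    {A W : Finset V} (hAW : ∀ a ∈ A, ∀ w ∈ W, G.Adj a w) (cA : ∑ i, l i / 2 = #A + 1)
    (cW : 2 * ∑ i, (l i / 2 + 1) + 4 ≤ #W) {i : Fin k} (hl : 2 ≤ l i) (he : Even (l i))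
    {w x : V} (hw : w ∈ W) (hx : x ∉ A) : ¬ G.Adj w x := by
  intro hwx
  obtain ⟨m, hm⟩ := he
  exact hF (isContained_of_path_outside hAW cA cW hw (q := [x]) (i := i) (s := l i / 2 - 1)
    ((isPathList_singleton x).cons hwx (by simpa using hwx.ne)) (by simpa using hx) (by simp)
    (by simp only [List.length_singleton]; omega) (by omega))

/-- If some `ℓ_i` is odd and at least `5`, any two edges `wx` and `w'x'` outside `A` with `w` and `w'`
in `W` satisfy `w' ∈ {w, x}`: otherwise they are disjoint or form a path that ends in `W`, and either
of these can be used in `P_{ℓ_i}`. -/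
theorem eq_or_eq_of_adj_outside {k : ℕ} {l : Fin k → ℕ} (hF : (linearForest l).Free G)
    {A W : Finset V} (hAW : ∀ a ∈ A, ∀ w ∈ W, G.Adj a w) (cA : ∑ i, l i / 2 = #A + 1)
    (cW : 2 * ∑ i, (l i / 2 + 1) + 4 ≤ #W) {i : Fin k} (hl : 5 ≤ l i) (hodd : Odd (l i))
    {w x w' x' : V} (hw : w ∈ W) (hx : x ∉ A) (hwx : G.Adj w x) (hw' : w' ∈ W) (hx' : x' ∉ A)
    (hwx' : G.Adj w' x') : w' = w ∨ w' = x := by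
  have hWA : ∀ v ∈ W, v ∉ A := fun v hv h => (hAW v h v hv).ne rfl
  have hpath : ∀ w ∈ W, ∀ x, x ∉ A → ∀ y, y ∉ A → G.Adj w x → G.Adj x y → w = y := by
    intro w hw x hx y hy hwx hxy
    by_contra hwy
    obtain ⟨m, hm⟩ := id hodd
    exact hF (isContained_of_path_outside hAW cA cW hw (q := [x, y]) (i := i) (s := l i / 2 - 1)
      (((isPathList_singleton y).cons hxy (by simpa using hxy.ne)).cons hwx
        (by simpa using ⟨hwx.ne, hwy⟩)) (by simpa using ⟨hx, hy⟩) (by simp)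
      (by simp only [List.length_cons, List.length_nil]; omega) (by omega))
  by_contra! h
  refine hF (isContained_of_two_edges_outside hAW cA cW hw hw' hx hx' hwx hwx' h.1.symm ?_ ?_
    h.2.symm hl hodd)
  · rintro rfl
    exact h.1 (hpath w' hw' x hx w (hWA w hw) hwx' hwx.symm)
  · rintro rfl
    exact h.2 (hpath w' hw' w hx' x hx hwx' hwx)

variable [Fintype V]

/-- Missing edges between `A` and `R` lower the degrees in `A`. -/
theorem sum_degree_add_card_le {A R : Finset V} {b N : ℕ} (hV : Fintype.card V = N + 1)
    (hA : #A = b) (hRA : ∀ v ∈ R, v ∉ A ∧ ∃ a ∈ A, ¬ G.Adj a v) :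
    ∑ a ∈ A, G.degree a + #R ≤ b * N := by
  have h1 : ∀ a ∈ A, G.degree a + #{v ∈ R | ¬ G.Adj a v} ≤ N := by
    intro a ha
    rw [degree_eq_card_filter, ← card_union_of_disjoint]
    · refine (card_le_card (t := univ.erase a) fun v hv => ?_).trans_eq
        (by rw [card_erase_of_mem (mem_univ a), card_univ, hV]; rfl)
      rw [mem_union, mem_filter, mem_filter] at hv
      refine mem_erase.2 ⟨?_, mem_univ v⟩
      rcases hv with hv | hv
      · exact hv.2.ne'
      · exact fun h => (hRA v hv.1).1 (h ▸ ha)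
    · exact disjoint_left.2 fun v hv hv' => (mem_filter.1 hv').2 (mem_filter.1 hv).2
  have h2 := sum_le_card_nsmul A _ N h1
  rw [sum_add_distrib, hA, smul_eq_mul] at h2
  have h3 : #R ≤ ∑ a ∈ A, #{v ∈ R | ¬ G.Adj a v} := by
    refine (card_le_card fun v hv => ?_).trans card_biUnion_le
    obtain ⟨-, a, ha, hav⟩ := hRA v hv
    exact mem_biUnion.2 ⟨a, ha, mem_filter.2 ⟨hv, hav⟩⟩
  omega

/-- All degrees outside `A` are at most `N / q`. Each vertex of `R`, which misses a neighbour in `A`,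
costs at least `N ^ (p - 1)` in the degree-power sum over `A`. The sum over `T`, which contains all
vertices outside `A` with a neighbour outside `A`, gains less than that per vertex of `R`: the set `T`
spans few edges, its size is at most `3 * #R`, and its degrees are small. -/
theorem sum_degree_pow_lt {A T R : Finset V} {b m q N p : ℕ} (hV : Fintype.card V = N + 1)
    (hA : #A = b) (hTA : ∀ v ∈ T, v ∉ A) (hT : ∀ v, v ∉ A → v ∉ T → ∀ u, G.Adj v u → u ∈ A)
    (hRA : ∀ v ∈ R, v ∉ A ∧ ∃ a ∈ A, ¬ G.Adj a v) (hR : R.Nonempty) (hTR : #T ≤ 3 * #R)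
    (hsmall : ∀ v, v ∉ A → q * G.degree v ≤ N) (hq : 3 * (b + 2 * m) < q)
    (hno : ∀ p, IsPathList G p → p.length ≠ m) (hp : 2 ≤ p) :
    ∑ v, G.degree v ^ p < b * N ^ p + (N + 1 - b) * b ^ p := by
  have hdN : ∀ v, G.degree v ≤ N := fun v => by
    have := G.degree_lt_card_verts v; omega
  have hr : 0 < #R := card_pos.2 hR
  have hN : 0 < N := by
    obtain ⟨v, hv⟩ := hR
    obtain ⟨hvA, a, ha, -⟩ := hRA v hv
    have : 1 < Fintype.card V := Fintype.one_lt_card_iff.2 ⟨v, a, fun h => hvA (h ▸ ha)⟩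
    omega
  obtain ⟨t, rfl⟩ : ∃ t, p = t + 2 := ⟨p - 2, by omega⟩
  have hmiss := sum_degree_add_card_le hV hA hRA
  have hsumA : ∑ v ∈ A, G.degree v ^ (t + 2) ≤ N ^ (t + 1) * ∑ v ∈ A, G.degree v := by
    rw [mul_sum]
    exact sum_le_sum fun v _ => by
      rw [pow_succ]; exact Nat.mul_le_mul_right _ (Nat.pow_le_pow_left (hdN v) _)
  have hdegT : ∑ v ∈ T, G.degree v ≤ (b + 2 * m) * #T := by
    have h1 : ∀ v ∈ T, G.degree v ≤ b + #{u ∈ T | G.Adj v u} := by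
      intro v hv
      rw [degree_eq_card_filter, ← hA]
      refine (card_le_card fun u hu => ?_).trans (card_union_le _ _)
      rw [mem_filter] at hu
      rw [mem_union, mem_filter]
      by_cases huA : u ∈ A
      · exact Or.inl huA
      · refine Or.inr ⟨?_, hu.2⟩
        by_contra huT
        exact hTA v hv (hT u huA huT v hu.2.symm)
    have h2 := sum_le_sum h1
    rw [sum_add_distrib, sum_const, smul_eq_mul] at h2
    have h3 := sum_degree_within_le hno T
    linarith
  have hsumT : ∑ v ∈ T, G.degree v ^ (t + 2) < N ^ (t + 1) * #R := by
    have h1 : q * ∑ v ∈ T, G.degree v ^ (t + 2) ≤ N ^ (t + 1) * ∑ v ∈ T, G.degree v := by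
      rw [mul_sum, mul_sum]
      refine sum_le_sum fun v hv => ?_
      calc q * G.degree v ^ (t + 2)
          = G.degree v ^ t * (q * G.degree v) * G.degree v := by ring
        _ ≤ N ^ t * N * G.degree v := by
            gcongr
            · exact hdN v
            · exact hsmall v (hTA v hv)
        _ = _ := by ring
    have hpos : 0 < N ^ (t + 1) * #R := by positivity
    have h2 : q * ∑ v ∈ T, G.degree v ^ (t + 2) < q * (N ^ (t + 1) * #R) := by
      calc _ ≤ N ^ (t + 1) * ∑ v ∈ T, G.degree v := h1
        _ ≤ N ^ (t + 1) * ((b + 2 * m) * (3 * #R)) :=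
            Nat.mul_le_mul_left _ (hdegT.trans (Nat.mul_le_mul_left _ hTR))
        _ = 3 * (b + 2 * m) * (N ^ (t + 1) * #R) := by ring
        _ < _ := Nat.mul_lt_mul_of_pos_right hq hpos
    exact lt_of_mul_lt_mul_left h2 (Nat.zero_le q)
  have hrest : ∑ v ∈ (A ∪ T)ᶜ, G.degree v ^ (t + 2) ≤ (N + 1 - b) * b ^ (t + 2) := by
    have h1 : ∀ v ∈ (A ∪ T)ᶜ, G.degree v ^ (t + 2) ≤ b ^ (t + 2) := by
      intro v hv
      rw [mem_compl, mem_union, not_or] at hv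
      refine Nat.pow_le_pow_left ?_ _
      rw [degree_eq_card_filter, ← hA]
      exact card_le_card fun u hu => hT v hv.1 hv.2 u (mem_filter.1 hu).2
    refine (sum_le_card_nsmul _ _ _ h1).trans ?_
    rw [smul_eq_mul, card_compl, hV]
    refine Nat.mul_le_mul_right _ (Nat.sub_le_sub_left ?_ _)
    rw [← hA]
    exact card_le_card subset_union_left
  rw [← sum_add_sum_compl (A ∪ T), sum_union (disjoint_left.2 fun v hv hv' => hTA v hv' hv)]
  have hfin : N ^ (t + 1) * ∑ v ∈ A, G.degree v + N ^ (t + 1) * #R ≤ b * N ^ (t + 2) := by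
    calc _ = N ^ (t + 1) * (∑ v ∈ A, G.degree v + #R) := by ring
      _ ≤ N ^ (t + 1) * (b * N) := Nat.mul_le_mul_left _ hmiss
      _ = _ := by ring
  omega

end

/-! ### Degree-power sums -/

theorem degreePowerSum_eq_of_iso {V W : Type*} [Fintype V] [Fintype W] {G : SimpleGraph V}
    {H : SimpleGraph W} (e : G ≃g H) (p : ℕ) : degreePowerSum p G = degreePowerSum p H := by
  refine Fintype.sum_equiv e.toEquiv _ _ fun v => ?_
  congr 1
  exact (e.degree_eq v).symm

theorem degreePowerSum_mono {V : Type*} [Fintype V] {G H : SimpleGraph V} (h : G ≤ H) (p : ℕ) :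
    degreePowerSum p G ≤ degreePowerSum p H :=
  sum_le_sum fun _ _ => Nat.pow_le_pow_left (SimpleGraph.degree_le_of_le h) p

theorem eq_of_degreePowerSum_eq {V : Type*} [Fintype V] {G H : SimpleGraph V} (h : G ≤ H) {p : ℕ}
    (hp : p ≠ 0) (heq : degreePowerSum p G = degreePowerSum p H) : G = H := by
  have h1 := (sum_eq_sum_iff_of_le fun v _ =>
    Nat.pow_le_pow_left (SimpleGraph.degree_le_of_le (v := v) h) p).1 heq
  refine le_antisymm h fun u v huv => ?_
  have h2 : G.degree u = H.degree u := Nat.pow_left_injective hp (h1 u (mem_univ u))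
  rw [degree_eq_card_filter, degree_eq_card_filter] at h2
  have hsub : ({w | G.Adj u w} : Finset V) ⊆ ({w | H.Adj u w} : Finset V) :=
    fun w hw => mem_filter.2 ⟨mem_univ w, h (mem_filter.1 hw).2⟩
  have h3 := eq_of_subset_of_card_le hsub h2.ge
  have h4 : v ∈ ({w | G.Adj u w} : Finset V) := by
    rw [h3]; exact mem_filter.2 ⟨mem_univ v, huv⟩
  exact (mem_filter.1 h4).2

/-! ### The graph `H(n, F)` -/

variable {k : ℕ} {l : Fin k → ℕ} {n : ℕ}

theorem extremalH_adj_inl {u v : Fin (forestParam l)} :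
    (extremalH n l).Adj (Sum.inl u) (Sum.inl v) ↔ u ≠ v := Iff.rfl

theorem extremalH_adj_inl_inr {u : Fin (forestParam l)} {v : Fin (n - forestParam l)} :
    (extremalH n l).Adj (Sum.inl u) (Sum.inr v) := trivial

theorem extremalH_adj_inr {u v : Fin (n - forestParam l)} :
    (extremalH n l).Adj (Sum.inr u) (Sum.inr v) ↔
      (∀ i, Odd (l i)) ∧ ((u.val = 0 ∧ v.val = 1) ∨ (u.val = 1 ∧ v.val = 0)) := by
  unfold extremalH
  split_ifs with h
  · exact ⟨fun h' => ⟨h, h'⟩, fun h' => h'.2⟩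
  · exact ⟨fun h' => h'.elim, fun h' => absurd h'.1 h⟩

theorem le_degreePowerSum_extremalH (l : Fin k → ℕ) (p : ℕ) {N : ℕ}
    (hb : forestParam l ≤ N + 1) :
    forestParam l * N ^ p + (N + 1 - forestParam l) * forestParam l ^ p ≤
      degreePowerSum p (extremalH (N + 1) l) := by
  unfold degreePowerSum
  rw [Fintype.sum_sum_type]
  refine add_le_add ?_ ?_
  · have := card_nsmul_le_sum univ
      (fun i => (extremalH (N + 1) l).degree (Sum.inl i) ^ p) (N ^ p) fun i _ => by
        refine Nat.pow_le_pow_left ?_ p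
        rw [degree_eq_card_filter]
        have h1 : #(univ.erase (Sum.inl i : Fin (forestParam l) ⊕ Fin (N + 1 - forestParam l)))
            = N := by
          rw [card_erase_of_mem (mem_univ _), card_univ, Fintype.card_sum, Fintype.card_fin,
            Fintype.card_fin]
          omega
        refine h1.ge.trans (card_le_card fun x hx => mem_filter.2 ⟨mem_univ x, ?_⟩)
        rcases x with j | j
        · exact fun h => (mem_erase.1 hx).1 (congrArg Sum.inl h.symm)
        · trivial
    simpa using this
  · have := card_nsmul_le_sum univ
      (fun i => (extremalH (N + 1) l).degree (Sum.inr i) ^ p) (forestParam l ^ p) fun i _ => by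
        refine Nat.pow_le_pow_left ?_ p
        rw [degree_eq_card_filter]
        have h1 : #(univ.map (Function.Embedding.inl :
            Fin (forestParam l) ↪ Fin (forestParam l) ⊕ Fin (N + 1 - forestParam l)))
            = forestParam l := by simp
        refine h1.ge.trans (card_le_card fun x hx => mem_filter.2 ⟨mem_univ x, ?_⟩)
        obtain ⟨j, -, rfl⟩ := mem_map.1 hx
        trivial
    simpa using this

theorem le_card_of_forall_pair {S : Finset ℕ} {s o : ℕ}
    (h : ∀ t < s, 2 * t + o ∈ S ∨ 2 * t + 1 + o ∈ S) : s ≤ #S := by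
  have h1 : range s ⊆ S.image fun j => (j - o) / 2 := by
    intro t ht
    rcases h t (mem_range.1 ht) with h | h
    · exact mem_image.2 ⟨_, h, by omega⟩
    · exact mem_image.2 ⟨_, h, by omega⟩
  simpa using (card_le_card h1).trans card_image_le

/-- Each path `P_ℓ` in `H(n, F)` has at least `⌊ℓ / 2⌋` vertices in the complete part: one of its
two near-perfect matchings avoids the extra edge, if there is one. -/
theorem le_card_isLeft (f : (linearForest l).Copy (extremalH n l)) (i : Fin k) :
    l i / 2 ≤ #{j : Fin (l i) | (f ⟨i, j⟩).isLeft = true} := by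
  set S : Finset ℕ := ({j : Fin (l i) | (f ⟨i, j⟩).isLeft = true} : Finset _).map Fin.valEmbedding
    with hS
  have hmem : ∀ (j : ℕ) (hj : j < l i), j ∉ S → ∃ u, f ⟨i, ⟨j, hj⟩⟩ = Sum.inr u := by
    intro j hj hjS
    rcases hf : f ⟨i, ⟨j, hj⟩⟩ with u | u
    · have h1 : (⟨j, hj⟩ : Fin (l i)) ∈ ({j : Fin (l i) | (f ⟨i, j⟩).isLeft = true} : Finset _) :=
        mem_filter.2 ⟨mem_univ _, by rw [hf]; rfl⟩
      exact absurd (mem_map_of_mem Fin.valEmbedding h1) hjS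
    · exact ⟨u, rfl⟩
  have hadj : ∀ (j : ℕ) (hj : j + 1 < l i), j ∉ S → j + 1 ∉ S → (∀ i, Odd (l i)) ∧
      ∃ u v, f ⟨i, ⟨j, by omega⟩⟩ = Sum.inr u ∧ f ⟨i, ⟨j + 1, hj⟩⟩ = Sum.inr v ∧
        ((u.val = 0 ∧ v.val = 1) ∨ (u.val = 1 ∧ v.val = 0)) := by
    intro j hj h1 h2
    obtain ⟨u, hu⟩ := hmem j (by omega) h1
    obtain ⟨v, hv⟩ := hmem (j + 1) hj h2
    have h3 : (linearForest l).Adj ⟨i, ⟨j, by omega⟩⟩ ⟨i, ⟨j + 1, hj⟩⟩ :=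
      ⟨i, _, _, rfl, rfl, SimpleGraph.pathGraph_adj.2 (Or.inl rfl)⟩
    have h4 : (extremalH n l).Adj (f ⟨i, ⟨j, by omega⟩⟩) (f ⟨i, ⟨j + 1, hj⟩⟩) := f.toHom.map_adj h3
    rw [hu, hv, extremalH_adj_inr] at h4
    exact ⟨h4.1, u, v, hu, hv, h4.2⟩
  have hinj : ∀ (j j' : ℕ) (hj : j < l i) (hj' : j' < l i),
      f ⟨i, ⟨j, hj⟩⟩ = f ⟨i, ⟨j', hj'⟩⟩ → j = j' := by
    intro j j' hj hj' h
    simpa using f.injective h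
  rw [← card_map Fin.valEmbedding, ← hS]
  by_cases h0 : ∀ t < l i / 2, 2 * t + 0 ∈ S ∨ 2 * t + 1 + 0 ∈ S
  · exact le_card_of_forall_pair h0
  push Not at h0
  obtain ⟨t, ht, ht1, ht2⟩ := h0
  obtain ⟨hodd, u, v, hu, hv, huv⟩ := hadj (2 * t) (by omega) ht1 ht2
  obtain ⟨r, hr⟩ := hodd i
  refine le_card_of_forall_pair (o := 1) fun t' ht' => ?_
  by_contra! h
  obtain ⟨-, u', v', hu', hv', huv'⟩ := hadj (2 * t' + 1) (by omega) h.1 h.2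
  have key : (u = u' ∧ v = v') ∨ (u = v' ∧ v = u') := by
    rcases huv with h1 | h1 <;> rcases huv' with h2 | h2
    · exact Or.inl ⟨Fin.ext (by omega), Fin.ext (by omega)⟩
    · exact Or.inr ⟨Fin.ext (by omega), Fin.ext (by omega)⟩
    · exact Or.inr ⟨Fin.ext (by omega), Fin.ext (by omega)⟩
    · exact Or.inl ⟨Fin.ext (by omega), Fin.ext (by omega)⟩
  rcases key with ⟨rfl, -⟩ | ⟨rfl, rfl⟩
  · have := hinj _ _ _ _ (hu.trans hu'.symm); omega
  · have h1 := hinj _ _ _ _ (hu.trans hv'.symm)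
    have h2 := hinj _ _ _ _ (hv.trans hu'.symm)
    omega

theorem extremalH_free (hl : 0 < ∑ i, l i / 2) (n : ℕ) :
    (linearForest l).Free (extremalH n l) := by
  rintro ⟨f⟩
  have h1 := sum_le_sum fun i (_ : i ∈ univ) => le_card_isLeft f i
  have h2 : ∑ i, #{j : Fin (l i) | (f ⟨i, j⟩).isLeft = true} ≤ forestParam l := by
    rw [← card_sigma]
    calc _ ≤ #(univ.map (Function.Embedding.inl :
          Fin (forestParam l) ↪ Fin (forestParam l) ⊕ Fin (n - forestParam l))) := by
          refine card_le_card_of_injOn f (fun x hx => ?_) f.injective.injOn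
          obtain ⟨i, j⟩ := x
          have hx' := (mem_filter.1 (mem_sigma.1 hx).2).2
          obtain ⟨u, hu⟩ := Sum.isLeft_iff.1 hx'
          exact mem_coe.2 (mem_map.2 ⟨u, mem_univ u, hu.symm⟩)
      _ = _ := by simp
  have h3 : forestParam l = ∑ i, l i / 2 - 1 := rfl
  omega

/-- A vertex set with the size of the complete part can be carried to it, and two chosen vertices
outside it to the ends of the extra edge. -/
theorem exists_equiv_sum {V : Type*} [Fintype V] {A : Finset V} {b n : ℕ} (hA : #A = b)
    (hV : Fintype.card V = n) {w x : V} (hw : w ∉ A) (hx : x ∉ A) (hwx : w ≠ x) :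
    ∃ e : V ≃ Fin b ⊕ Fin (n - b), (∀ v ∈ A, ∃ i, e v = Sum.inl i) ∧
      (∀ v, v ∉ A → ∃ j, e v = Sum.inr j) ∧ (∃ j, e w = Sum.inr j ∧ j.val = 0) ∧
      ∃ j, e x = Sum.inr j ∧ j.val = 1 := by
  have hc : Fintype.card {v // v ∉ A} = n - b := by
    rw [Fintype.card_subtype_compl, hV, Fintype.card_coe, hA]
  have h2 : 1 < n - b := by
    rw [← hc]
    exact Fintype.one_lt_card_iff.2 ⟨⟨w, hw⟩, ⟨x, hx⟩, fun h => hwx (congrArg Subtype.val h)⟩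
  let f := Fintype.equivFinOfCardEq hc
  let z : Fin (n - b) := ⟨0, by omega⟩
  let o : Fin (n - b) := ⟨1, h2⟩
  let f' := f.trans (Equiv.swap (f ⟨w, hw⟩) z)
  have hf'w : f' ⟨w, hw⟩ = z := Equiv.swap_apply_left _ _
  have hf'x : f' ⟨x, hx⟩ ≠ z := by
    rw [← hf'w]
    exact fun h => hwx (congrArg Subtype.val (f'.injective h)).symm
  let g := f'.trans (Equiv.swap (f' ⟨x, hx⟩) o)
  have hgw : g ⟨w, hw⟩ = z := by
    change Equiv.swap (f' ⟨x, hx⟩) o (f' ⟨w, hw⟩) = z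
    rw [hf'w]
    exact Equiv.swap_apply_of_ne_of_ne hf'x.symm (by simp [z, o])
  have hgx : g ⟨x, hx⟩ = o := Equiv.swap_apply_left _ _
  let a : {v // v ∈ A} ≃ Fin b := Fintype.equivFinOfCardEq (by rw [Fintype.card_coe, hA])
  have he : ∀ (v : V) (hv : v ∉ A),
      ((Equiv.sumCompl (· ∈ A)).symm.trans (a.sumCongr g)) v = Sum.inr (g ⟨v, hv⟩) := by
    intro v hv
    simp [Equiv.sumCompl_symm_apply_of_neg hv]
  refine ⟨(Equiv.sumCompl (· ∈ A)).symm.trans (a.sumCongr g), fun v hv => ⟨a ⟨v, hv⟩, ?_⟩,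
    fun v hv => ⟨_, he v hv⟩, ⟨_, he w hw, by rw [hgw]⟩, ⟨_, he x hx, by rw [hgx]⟩⟩
  simp [Equiv.sumCompl_symm_apply_of_pos hv]

/-! ### Extremal graphs -/

/-- A graph that splits into `A`, completely joined to the rest, and a rest that spans at most the
edges allowed by `H(n, F)`, is a spanning subgraph of `H(n, F)` up to isomorphism. -/
theorem exists_equiv_extremalH {V : Type*} [Fintype V] {G : SimpleGraph V} {A : Finset V}
    (hA : #A = forestParam l) (hV : Fintype.card V = n) (hn : forestParam l + 2 ≤ n)
    (heven : (∃ i, Even (l i)) → ∀ w, w ∉ A → ∀ x, x ∉ A → ¬ G.Adj w x)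
    (hodd : (∀ i, Odd (l i)) → ∀ w, w ∉ A → ∀ x, x ∉ A → G.Adj w x →
      ∀ w', w' ∉ A → ∀ x', x' ∉ A → G.Adj w' x' → w' = w ∨ w' = x) :
    ∃ e : V ≃ Fin (forestParam l) ⊕ Fin (n - forestParam l),
      ∀ u v, G.Adj u v → (extremalH n l).Adj (e u) (e v) := by
  obtain ⟨w, x, hw, hx, hwx, hedge⟩ : ∃ w x, w ∉ A ∧ x ∉ A ∧ w ≠ x ∧
      ∀ u, u ∉ A → ∀ v, v ∉ A → G.Adj u v → (∀ i, Odd (l i)) ∧ (u = w ∨ u = x) := by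
    by_cases h : ∃ w x, w ∉ A ∧ x ∉ A ∧ G.Adj w x
    · obtain ⟨w, x, hw, hx, hadj⟩ := h
      have ho : ∀ i, Odd (l i) := by
        intro i
        rw [← Nat.not_even_iff_odd]
        exact fun hi => heven ⟨i, hi⟩ w hw x hx hadj
      exact ⟨w, x, hw, hx, hadj.ne, fun u hu v hv huv => ⟨ho, hodd ho w hw x hx hadj u hu v hv huv⟩⟩
    · have h1 : 1 < #Aᶜ := by rw [card_compl, hV, hA]; omega
      obtain ⟨w, hw, x, hx, hwx⟩ := one_lt_card.1 h1
      exact ⟨w, x, mem_compl.1 hw, mem_compl.1 hx, hwx,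
        fun u hu v hv huv => absurd ⟨u, v, hu, hv, huv⟩ h⟩
  obtain ⟨e, heA, heA', ⟨z, hz, hz0⟩, ⟨o, ho, ho1⟩⟩ := exists_equiv_sum hA hV hw hx hwx
  refine ⟨e, fun u v huv => ?_⟩
  by_cases hu : u ∈ A <;> by_cases hv : v ∈ A
  · obtain ⟨i, hi⟩ := heA u hu
    obtain ⟨j, hj⟩ := heA v hv
    rw [hi, hj, extremalH_adj_inl]
    rintro rfl
    exact huv.ne (e.injective (hi.trans hj.symm))
  · obtain ⟨i, hi⟩ := heA u hu
    obtain ⟨j, hj⟩ := heA' v hv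
    rw [hi, hj]
    exact extremalH_adj_inl_inr
  · obtain ⟨i, hi⟩ := heA' u hu
    obtain ⟨j, hj⟩ := heA v hv
    rw [hi, hj]
    exact extremalH_adj_inl_inr.symm
  · obtain ⟨hall, hu'⟩ := hedge u hu v hv huv
    obtain ⟨-, hv'⟩ := hedge v hv u hu huv.symm
    rcases hu' with rfl | rfl <;> rcases hv' with rfl | rfl
    · exact absurd rfl huv.ne
    · rw [hz, ho, extremalH_adj_inr]; exact ⟨hall, Or.inl ⟨hz0, ho1⟩⟩
    · rw [hz, ho, extremalH_adj_inr]; exact ⟨hall, Or.inr ⟨ho1, hz0⟩⟩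
    · exact absurd rfl huv.ne

/-- An `F`-free graph on many vertices has a smaller degree-power sum than `H(n, F)`, or it is a
spanning subgraph of `H(n, F)` up to isomorphism. -/
theorem degreePowerSum_lt_or_exists_equiv (l : Fin k → ℕ) (hk : 2 ≤ k) (hl : ∀ i, 2 ≤ l i)
    (hl3 : ∃ i, l i ≠ 3) : ∃ n₀ : ℕ, forestParam l ≤ n₀ ∧ ∀ p, 2 ≤ p → ∀ n, n₀ ≤ n →
      ∀ G : SimpleGraph (Fin n), (linearForest l).Free G →
        degreePowerSum p G < degreePowerSum p (extremalH n l) ∨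
          ∃ e : Fin n ≃ Fin (forestParam l) ⊕ Fin (n - forestParam l),
            ∀ u v, G.Adj u v → (extremalH n l).Adj (e u) (e v) := by
  have hb : ∑ i, l i / 2 = forestParam l + 1 := by
    have h1 := single_le_sum (f := fun i => l i / 2) (fun j _ => Nat.zero_le _)
      (mem_univ (⟨0, by omega⟩ : Fin k))
    have h2 := hl ⟨0, by omega⟩
    have h3 : forestParam l = ∑ i, l i / 2 - 1 := rfl
    omega
  set b := forestParam l with hbdef
  set m := ∑ i, l i with hm
  set c := ∑ i, (l i / 2 + 1) with hc
  set q := 3 * (b + 2 * m) + 2 * b + 2 with hq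
  obtain ⟨n₁, hn₁⟩ := exists_dominating_set l hb (q := q) (by omega)
  refine ⟨n₁ + 2 * (b + 2 * c + 4) + 2, by omega, fun p hp n hn G hF => ?_⟩
  obtain ⟨N, rfl⟩ : ∃ N, n = N + 1 := ⟨n - 1, by omega⟩
  rw [or_iff_not_imp_left, not_lt]
  intro hle
  have hlow := (le_degreePowerSum_extremalH l p (N := N) (by omega)).trans hle
  rw [← hbdef] at hlow
  have hV : Fintype.card (Fin (N + 1)) = N + 1 := Fintype.card_fin _
  have hno : ∀ p, IsPathList G p → p.length ≠ m := fun p hp hlen =>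
    hF (isContained_of_isPathList hp hlen)
  have hsq : b * N ^ 2 ≤ ∑ v, G.degree v ^ 2 := by
    obtain ⟨t, rfl⟩ : ∃ t, p = t + 2 := ⟨p - 2, by omega⟩
    have h1 : degreePowerSum (t + 2) G ≤ N ^ t * ∑ v, G.degree v ^ 2 := by
      rw [mul_sum]
      refine sum_le_sum fun v _ => ?_
      rw [pow_add]
      have := G.degree_lt_card_verts v
      exact Nat.mul_le_mul_right _ (Nat.pow_le_pow_left (by omega) _)
    have h2 : N ^ t * (b * N ^ 2) ≤ N ^ t * ∑ v, G.degree v ^ 2 := by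
      calc N ^ t * (b * N ^ 2) = b * N ^ (t + 2) := by ring
        _ ≤ _ := (Nat.le_add_right _ _).trans (hlow.trans h1)
    exact Nat.le_of_mul_le_mul_left h2 (pow_pos (by omega) t)
  obtain ⟨A, hA, hbig, hsmall⟩ := hn₁ (Fin (N + 1)) G N hV (by omega) hF hsq
  set W : Finset (Fin (N + 1)) := {v | v ∉ A ∧ ∀ a ∈ A, G.Adj a v} with hW
  set R : Finset (Fin (N + 1)) := {v | v ∉ A ∧ ∃ a ∈ A, ¬ G.Adj a v} with hR
  have hRA : ∀ v ∈ R, v ∉ A ∧ ∃ a ∈ A, ¬ G.Adj a v := fun v hv => (mem_filter.1 hv).2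
  have hAW : ∀ a ∈ A, ∀ w ∈ W, G.Adj a w := fun a ha w hw => (mem_filter.1 hw).2.2 a ha
  have hWR : ∀ v, v ∉ A → v ∉ R → v ∈ W := by
    intro v hvA hvR
    refine mem_filter.2 ⟨mem_univ v, hvA, fun a ha => ?_⟩
    by_contra h
    exact hvR (mem_filter.2 ⟨mem_univ v, hvA, a, ha, h⟩)
  have hRcard : 2 * #R ≤ N := by
    have h1 := sum_degree_add_card_le hV hA hRA
    have h2 := sum_le_sum hbig
    rw [sum_const, sum_add_distrib, sum_const, ← mul_sum, hA, smul_eq_mul, smul_eq_mul] at h2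
    have h3 : q * #R ≤ b * N := by nlinarith
    have h4 : 2 * (b + 1) * #R ≤ q * #R := Nat.mul_le_mul_right _ (by omega)
    have h5 : (b + 1) * (2 * #R) ≤ (b + 1) * N := by linarith
    exact Nat.le_of_mul_le_mul_left h5 (Nat.succ_pos b)
  have hWcard : 2 * c + 4 ≤ #W := by
    have h1 : (univ : Finset (Fin (N + 1))) ⊆ A ∪ R ∪ W := by
      intro v _
      by_cases hvA : v ∈ A
      · simp [hvA]
      · by_cases hvR : v ∈ R
        · simp [hvR]
        · simp [hWR v hvA hvR]
    have h2 := (card_le_card h1).trans ((card_union_le _ _).trans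
      (Nat.add_le_add_right (card_union_le _ _) _))
    rw [card_univ, hV, hA] at h2
    omega
  have cA : ∑ i, l i / 2 = #A + 1 := by rw [hA, hb]
  have heven : (∃ i, Even (l i)) → ∀ w ∈ W, ∀ x, x ∉ A → ¬ G.Adj w x :=
    fun ⟨i, hi⟩ w hw x hx => not_adj_outside_of_even hF hAW cA hWcard (hl i) hi hw hx
  have hodd : (∀ i, Odd (l i)) → ∀ w ∈ W, ∀ x, x ∉ A → G.Adj w x →
      ∀ w' ∈ W, ∀ x', x' ∉ A → G.Adj w' x' → w' = w ∨ w' = x := by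
    intro ho w hw x hx hwx w' hw' x' hx' hwx'
    obtain ⟨i, hi⟩ := hl3
    have h5 : 5 ≤ l i := by
      obtain ⟨r, hr⟩ := ho i
      have := hl i
      omega
    exact eq_or_eq_of_adj_outside hF hAW cA hWcard h5 (ho i) hw hx hwx hw' hx' hwx'
  rcases R.eq_empty_or_nonempty with hR0 | hRne
  · have hAW' : ∀ v, v ∉ A → v ∈ W := fun v hv => hWR v hv (by rw [hR0]; exact notMem_empty v)
    exact exists_equiv_extremalH hA hV (by omega) (fun h w hw => heven h w (hAW' w hw))
      fun h w hw x hx hwx w' hw' => hodd h w (hAW' w hw) x hx hwx w' (hAW' w' hw')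
  · exfalso
    set W₁ : Finset (Fin (N + 1)) := {w ∈ W | ∃ x, x ∉ A ∧ G.Adj w x} with hW₁
    have hW₁card : #W₁ ≤ 2 := by
      rcases W₁.eq_empty_or_nonempty with h | ⟨w, hw⟩
      · rw [h]; simp
      obtain ⟨hw, x, hx, hwx⟩ := mem_filter.1 hw
      have ho : ∀ i, Odd (l i) := by
        intro i
        rw [← Nat.not_even_iff_odd]
        exact fun hi => heven ⟨i, hi⟩ w hw x hx hwx
      refine (card_le_card (t := {w, x}) fun w' hw' => ?_).trans card_le_two
      obtain ⟨hw', x', hx', hwx'⟩ := mem_filter.1 hw'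
      simpa using hodd ho w hw x hx hwx w' hw' x' hx' hwx'
    have hlt := sum_degree_pow_lt (A := A) (T := R ∪ W₁) (R := R) (p := p) hV hA
      (by
        intro v hv
        rcases mem_union.1 hv with hv | hv
        · exact (hRA v hv).1
        · exact (mem_filter.1 (mem_filter.1 hv).1).2.1)
      (by
        intro v hvA hvT u hvu
        rw [mem_union, not_or] at hvT
        by_contra hu
        exact hvT.2 (mem_filter.2 ⟨hWR v hvA hvT.1, u, hu, hvu⟩))
      hRA hRne (by have := card_union_le R W₁; have := card_pos.2 hRne; omega) hsmall
      (m := m) (by omega) hno hp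
    exact absurd hlow (not_le.2 hlt)

theorem exists_forall_isExtremalPow_iff (l : Fin k → ℕ) (hk : 2 ≤ k) (hl : ∀ i, 2 ≤ l i)
    (hl3 : ∃ i, l i ≠ 3) : ∃ n₀ : ℕ, ∀ p : ℕ, 2 ≤ p → ∀ n : ℕ, n₀ ≤ n →
      exPow p n (linearForest l) = degreePowerSum p (extremalH n l) ∧
      ∀ G : SimpleGraph (Fin n),
        IsExtremalPow p n (linearForest l) G ↔ Nonempty (G ≃g extremalH n l) := by
  obtain ⟨n₀, hbn, h⟩ := degreePowerSum_lt_or_exists_equiv l hk hl hl3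
  refine ⟨n₀, fun p hp n hn => ?_⟩
  have hpos : 0 < ∑ i, l i / 2 :=
    sum_pos (fun i _ => Nat.div_pos (hl i) two_pos) ⟨⟨0, by omega⟩, mem_univ _⟩
  have hfree : ∀ G : SimpleGraph (Fin n), Nonempty (G ≃g extremalH n l) →
      (linearForest l).Free G := fun G ⟨e⟩ =>
    (SimpleGraph.free_congr_right e).2 (extremalH_free hpos n)
  have hle : ∀ G : SimpleGraph (Fin n), (linearForest l).Free G →
      degreePowerSum p G ≤ degreePowerSum p (extremalH n l) ∧
      (degreePowerSum p G = degreePowerSum p (extremalH n l) → Nonempty (G ≃g extremalH n l)) := by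
    intro G hG
    rcases h p hp n hn G hG with hlt | ⟨e, he⟩
    · exact ⟨hlt.le, fun heq => absurd heq hlt.ne⟩
    · have hsub : G ≤ (extremalH n l).comap e := fun u v huv => he u v huv
      let i : (extremalH n l).comap e ≃g extremalH n l := SimpleGraph.Iso.comap e _
      rw [← degreePowerSum_eq_of_iso i p]
      refine ⟨degreePowerSum_mono hsub p, fun heq => ?_⟩
      rw [eq_of_degreePowerSum_eq hsub (by omega) heq]
      exact ⟨i⟩
  have hex : exPow p n (linearForest l) = degreePowerSum p (extremalH n l) := by
    refine le_antisymm (Finset.sup_le fun G hG => (hle G (mem_filter.1 hG).2).1) ?_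
    let e : Fin n ≃ Fin (forestParam l) ⊕ Fin (n - forestParam l) :=
      (finCongr (by omega)).trans finSumFinEquiv.symm
    let i : (extremalH n l).comap e ≃g extremalH n l := SimpleGraph.Iso.comap e _
    rw [← degreePowerSum_eq_of_iso i p]
    exact Finset.le_sup (f := fun G => degreePowerSum p G)
      (mem_filter.2 ⟨mem_univ _, hfree _ ⟨i⟩⟩)
  refine ⟨hex, fun G => ⟨fun hG => (hle G hG.1).2 (hG.2.trans hex), fun hG => ⟨hfree G hG, ?_⟩⟩⟩
  obtain ⟨e⟩ := hG
  rw [hex, degreePowerSum_eq_of_iso e p]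

end LinearForestExtremal

theorem theorem3p3 :
    (∀ (k : ℕ) (l : Fin k → ℕ), 2 ≤ k → (∀ i, 2 ≤ l i) → (∃ i, l i ≠ 3) →
      ∃ n₀ : ℕ, ∀ p : ℕ, 2 ≤ p → ∀ n : ℕ, n₀ ≤ n →
        exPow p n (linearForest l) = degreePowerSum p (extremalH n l) ∧
        ∀ G : SimpleGraph (Fin n),
          IsExtremalPow p n (linearForest l) G ↔ Nonempty (G ≃g extremalH n l)) ∧
    (∀ k m : ℕ, 2 ≤ k → 2 ≤ m → m ≠ 3 →
      ∃ n₀ : ℕ, ∀ p : ℕ, 2 ≤ p → ∀ n : ℕ, n₀ ≤ n →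
        exPow p n (linearForest fun _ : Fin k => m) =
          degreePowerSum p (extremalH n fun _ : Fin k => m) ∧
        ∀ G : SimpleGraph (Fin n),
          IsExtremalPow p n (linearForest fun _ : Fin k => m) G ↔
            Nonempty (G ≃g extremalH n fun _ : Fin k => m)) := by
  refine ⟨fun k l => LinearForestExtremal.exists_forall_isExtremalPow_iff l, fun k m hk hm hm3 => ?_⟩
  exact LinearForestExtremal.exists_forall_isExtremalPow_iff (fun _ : Fin k => m) hk (fun _ => hm)
    ⟨⟨0, by omega⟩, hm3⟩
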